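/- All rings are commutative. A \emph{partial E-ring} is a triple $(D;V,\exp)$ where $D$ is a $\mathbb{Q}$-algebra, $V\subseteq D$ is a $\mathbb{Q}$-vector subspace containing $\mathbb{Q}$, and $\exp:(V,+)\to(D^{*},\cdot)$ is a group homomorphism. Its \emph{free 1-extension} is $(D[t^{A}];D,\exp')$, where $A$ is a complement of $V$ in $D$ as $\mathbb{Q}$-vector spaces, $D[t^{A}]$ is the group ring of $(A,+)$ over $D$, and $\exp'(v+a)=\exp(v)\,t^{a}$ for $v\in V$, $a\in A$ (up to isomorphism over $D$ it does not depend on $A$). An \emph{E-ideal} of $(D;V,\exp)$ is an ideal $I$ of $D$ such that $\exp(v)-1\in I$ for every $v\in I\cap V$; it is \emph{prime} if it is prime as an ideal. Let $K$ be a field of characteristic $0$ with a group homomorphism $E:(K,+)\to(K^{*},\cdot)$, and let $\bar x=(x_1,\dots,x_n)$, $n\ge 0$. Let $R_0=K[\bar x]$, regarded as a partial E-ring with $V=K$ and $\exp=E$, let $R_{m+1}$ be the free 1-extension of $R_m$, and let $K[\bar x]^{E}=\bigcup_m R_m$, with its induced everywhere defined exponential map, be the E-ring of exponential polynomials. \textbf{Proposition.}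 If $f\in K[\bar x]^{E}$ is irreducible, then the E-ideal $(f)^{E}$ of $K[\bar x]^{E}$ generated by $f$, i.e.\ the smallest E-ideal containing $f$, is prime. -/

import Mathlib

/-- A partial E-ring `(D; V, exp)`: a commutative `ℚ`-algebra `D`, a `ℚ`-subspace `V` of `D`
containing `ℚ`, and a group homomorphism `exp : (V, +) → (Dˣ, ·)`. -/
structure PartialERing where
  carrier : Type*
  [commRing : CommRing carrier]
  [algebra : Algebra ℚ carrier]
  /-- the domain `V` of the exponential map -/
  dom : Submodule ℚ carrier
  algebraMap_mem : ∀ q : ℚ, algebraMap ℚ carrier q ∈ dom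
  exp : Multiplicative dom →* carrierˣ

namespace PartialERing

instance : CoeSort PartialERing (Type _) := ⟨PartialERing.carrier⟩

attribute [instance] PartialERing.commRing PartialERing.algebra

section FreeExtension

variable (D : PartialERing) (A : Submodule ℚ D) (hA : IsCompl D.dom A)

/-- For `D = V ⊕ A`, the group homomorphism `(D, +) → D[t^A]ˣ`, `v + a ↦ exp(v) t^a`.
The group ring `D[t^A]` is `AddMonoidAlgebra D A`. -/
noncomputable def expExt : Multiplicative D →* (AddMonoidAlgebra D A)ˣ :=
  ((Units.map (AddMonoidAlgebra.singleZeroAlgHom (R := ℚ) (A := D) (M := A) :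
        D →* AddMonoidAlgebra D A)).comp
      (D.exp.comp (AddMonoidHom.toMultiplicative
        (D.dom.projectionOnto A hA).toAddMonoidHom))) *
    ((AddMonoidAlgebra.of D A).toHomUnits.comp
      (AddMonoidHom.toMultiplicative (A.projectionOnto D.dom hA.symm).toAddMonoidHom))

theorem singleZero_injective :
    Function.Injective (AddMonoidAlgebra.singleZeroAlgHom (R := ℚ) (A := D) (M := A)).toLinearMap :=
  fun _ _ h => AddMonoidAlgebra.single_right_injective h

/-- The free extension `(D[t^A], D, exp')` of `(D; V, exp)` given by a complement `A` of `V`: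
the group ring of `A` over `D`, with domain of exponentiation `D = V ⊕ A` and
`exp'(v + a) = exp(v) t^a`. -/
noncomputable def freeExtOf : PartialERing where
  carrier := AddMonoidAlgebra D A
  dom := LinearMap.range
    (AddMonoidAlgebra.singleZeroAlgHom (R := ℚ) (A := D) (M := A)).toLinearMap
  algebraMap_mem q := ⟨algebraMap ℚ D q,
    (AddMonoidAlgebra.singleZeroAlgHom (R := ℚ) (A := D) (M := A)).commutes q⟩
  exp := (D.expExt A hA).comp (AddMonoidHom.toMultiplicative
    (LinearEquiv.ofInjective _ (D.singleZero_injective A)).symm.toLinearMap.toAddMonoidHom)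

end FreeExtension

variable (D : PartialERing)

/-- A complement of the domain of `exp`, as `ℚ`-vector spaces. -/
noncomputable def compl : Submodule ℚ D := (Submodule.exists_isCompl D.dom).choose

theorem isCompl_compl : IsCompl D.dom D.compl := (Submodule.exists_isCompl D.dom).choose_spec

/-- The free 1-extension of `D` (independent of the complement, up to isomorphism over `D`). -/
noncomputable def freeExt : PartialERing := D.freeExtOf D.compl D.isCompl_compl

/-- The inclusion of `D` in its free 1-extension. -/
noncomputable def incl : D →ₐ[ℚ] D.freeExt :=
  AddMonoidAlgebra.singleZeroAlgHom (R := ℚ) (A := D) (M := D.compl)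

/-- The exponential map of the free 1-extension, as a map on all of `D`. -/
noncomputable def expNext : Multiplicative D →* (D.freeExt)ˣ :=
  D.expExt D.compl D.isCompl_compl

theorem mem_dom_freeExt (x : D) : D.incl x ∈ D.freeExt.dom := ⟨x, rfl⟩

theorem exp_freeExt (x : D) :
    D.freeExt.exp (Multiplicative.ofAdd ⟨D.incl x, D.mem_dom_freeExt x⟩) =
      D.expNext (Multiplicative.ofAdd x) := by
  have h : (LinearEquiv.ofInjective _ (D.singleZero_injective D.compl)).symm
      ⟨D.incl x, D.mem_dom_freeExt x⟩ = x := by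
    rw [LinearEquiv.symm_apply_eq]
    rfl
  change D.expNext (Multiplicative.ofAdd
    ((LinearEquiv.ofInjective _ (D.singleZero_injective D.compl)).symm
      ⟨D.incl x, D.mem_dom_freeExt x⟩)) = _
  rw [h]

theorem expNext_of_mem (v : D.dom) :
    D.expNext (Multiplicative.ofAdd (v : D)) =
      Units.map (D.incl : D →* D.freeExt) (D.exp (Multiplicative.ofAdd v)) := by
  have h1 : D.dom.projectionOnto D.compl D.isCompl_compl (v : D) = v :=
    Submodule.projectionOnto_apply_left _ _
  have h2 : D.compl.projectionOnto D.dom D.isCompl_compl.symm (v : D) = 0 :=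
    Submodule.projectionOnto_apply_right _ _
  change Units.map (AddMonoidAlgebra.singleZeroAlgHom (R := ℚ) (A := D) (M := D.compl) :
        D →* AddMonoidAlgebra D D.compl) (D.exp (Multiplicative.ofAdd
        (D.dom.projectionOnto D.compl D.isCompl_compl (v : D)))) *
    (AddMonoidAlgebra.of D D.compl).toHomUnits (Multiplicative.ofAdd
      (D.compl.projectionOnto D.dom D.isCompl_compl.symm (v : D))) = _
  rw [h1, h2, ofAdd_zero, map_one]
  exact mul_one _

/-- The canonical filtration: `R₀ = D`, and `Rₙ₊₁` is the free 1-extension of `Rₙ`. -/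
noncomputable def stage : ℕ → PartialERing
  | 0 => D
  | n + 1 => (stage n).freeExt

/-- The inclusion `Rₘ → Rₙ` for `m ≤ n`. -/
noncomputable def trans (m n : ℕ) (h : m ≤ n) : D.stage m →ₐ[ℚ] D.stage n :=
  Nat.leRecOn (C := fun k => D.stage m →ₐ[ℚ] D.stage k) h
    (fun {k} g => (D.stage k).incl.comp g) (AlgHom.id ℚ _)

theorem trans_self (m : ℕ) : D.trans m m le_rfl = AlgHom.id ℚ _ := Nat.leRecOn_self _

theorem trans_succ (m n : ℕ) (h : m ≤ n) :
    D.trans m (n + 1) (h.trans n.le_succ) = (D.stage n).incl.comp (D.trans m n h) :=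
  Nat.leRecOn_succ h _

instance : DirectedSystem (fun n => (D.stage n : Type _)) (D.trans · · ·) where
  map_self m x := by rw [trans_self]; rfl
  map_map k j i hij hjk x := by
    induction k, hjk using Nat.le_induction with
    | base => rw [trans_self]; rfl
    | succ n hn ih =>
      rw [trans_succ _ _ _ hn, trans_succ _ _ _ (hij.trans hn)]
      exact congrArg (D.stage n).incl ih

/-- The union `R^E = ⋃ₙ Rₙ` of the canonical filtration. -/
abbrev union : Type _ := DirectLimit (fun n => (D.stage n : Type _)) D.trans

/-- The inclusion of the `n`-th stage in the union. -/
noncomputable def ofStage (n : ℕ) : D.stage n →+* D.union where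
  toFun x := ⟦⟨n, x⟩⟧
  map_one' := (DirectLimit.one_def (f := D.trans) n).symm
  map_zero' := (DirectLimit.zero_def (f := D.trans) n).symm
  map_mul' x y := (DirectLimit.mul_def (f := D.trans) n x y).symm
  map_add' x y := (DirectLimit.add_def (f := D.trans) n x y).symm

theorem ofStage_trans (m n : ℕ) (h : m ≤ n) (x : D.stage m) :
    D.ofStage n (D.trans m n h x) = D.ofStage m x :=
  (Quotient.sound (DirectLimit.r_of_le D.trans ⟨m, x⟩ n h) : (⟦⟨m, x⟩⟧ : D.union) = _).symm

theorem ofStage_incl (n : ℕ) (x : D.stage n) :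
    D.ofStage (n + 1) ((D.stage n).incl x) = D.ofStage n x := by
  have h := D.ofStage_trans n (n + 1) n.le_succ x
  rw [trans_succ _ _ _ le_rfl, trans_self] at h
  exact h

noncomputable instance : Algebra ℚ D.union :=
  Algebra.ofModule smul_mul_assoc mul_smul_comm

/-- The exponential of elements of the `n`-th stage, with values in the union. -/
noncomputable def expStage (n : ℕ) : Multiplicative (D.stage n) →* (D.union)ˣ :=
  (Units.map (D.ofStage (n + 1) : D.stage (n + 1) →* D.union)).comp (D.stage n).expNext

theorem expStage_incl (n : ℕ) (x : D.stage n) :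
    D.expStage (n + 1) (Multiplicative.ofAdd ((D.stage n).incl x)) =
      D.expStage n (Multiplicative.ofAdd x) := by
  have h := (D.stage (n + 1)).expNext_of_mem ⟨_, (D.stage n).mem_dom_freeExt x⟩
  have h' : (D.stage (n + 1)).exp
      (Multiplicative.ofAdd ⟨(D.stage n).incl x, (D.stage n).mem_dom_freeExt x⟩) =
      (D.stage n).expNext (Multiplicative.ofAdd x) := (D.stage n).exp_freeExt x
  rw [h'] at h
  ext
  refine (congrArg (fun u : (D.stage (n + 2))ˣ => D.ofStage (n + 2) u) h).trans ?_
  exact D.ofStage_incl (n + 1) _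

theorem expStage_trans (m n : ℕ) (h : m ≤ n) (x : D.stage m) :
    D.expStage m (Multiplicative.ofAdd x) =
      D.expStage n (Multiplicative.ofAdd (D.trans m n h x)) := by
  induction n, h using Nat.le_induction with
  | base => rw [trans_self]; rfl
  | succ n hn ih =>
    rw [trans_succ _ _ _ hn, ih]
    exact (D.expStage_incl n _).symm

/-- The total exponential map of `R^E`. -/
noncomputable def unionExp : Multiplicative D.union →* (D.union)ˣ where
  toFun x := DirectLimit.lift D.trans (fun n y => D.expStage n (Multiplicative.ofAdd y))
    (fun m n h y => D.expStage_trans m n h y) x.toAdd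
  map_one' := by
    rw [toAdd_one, DirectLimit.zero_def (f := D.trans) 0, DirectLimit.lift_def]
    exact map_one (D.expStage 0)
  map_mul' x y := by
    rw [toAdd_mul]
    refine DirectLimit.induction₂ D.trans (fun n a b => ?_) x.toAdd y.toAdd
    rw [DirectLimit.add_def, DirectLimit.lift_def, DirectLimit.lift_def, DirectLimit.lift_def]
    exact map_mul (D.expStage n) _ _

/-- The free completion `R^E` of a partial E-ring `R`; its exponential map is total. -/
noncomputable def freeCompletion : PartialERing where
  carrier := D.union
  dom := ⊤
  algebraMap_mem _ := Submodule.mem_top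
  exp := D.unionExp.comp (AddMonoidHom.toMultiplicative (Submodule.subtype ⊤).toAddMonoidHom)

/-- An ideal `I` such that `exp v - 1 ∈ I` for all `v ∈ I ∩ V`. -/
def IsEIdeal (I : Ideal D) : Prop :=
  ∀ v : D.dom, (v : D) ∈ I → (D.exp (Multiplicative.ofAdd v) : D) - 1 ∈ I

/-- An E-ideal is prime if it is prime as an ideal. -/
def IsPrimeEIdeal (I : Ideal D) : Prop := D.IsEIdeal I ∧ I.IsPrime

/-- The E-ideal generated by a set: the intersection of all E-ideals containing it. -/
def eSpan (s : Set D) : Ideal D := sInf {I : Ideal D | D.IsEIdeal I ∧ s ⊆ I}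

theorem isEIdeal_eSpan (s : Set D) : D.IsEIdeal (D.eSpan s) := by
  intro v hv
  refine (Submodule.mem_sInf).2 fun I hI => hI.1 v ((Submodule.mem_sInf).1 hv I hI)

end PartialERing

/-- The polynomial ring `R[x₁, …, xₙ]` over an E-ring `(R, E)`, as a partial E-ring whose
exponential map is `E`, defined only on the constants. -/
noncomputable def polyERing {R : Type*} [CommRing R] [Algebra ℚ R] (E : Multiplicative R →* Rˣ)
    (n : ℕ) : PartialERing where
  carrier := MvPolynomial (Fin n) R
  dom := LinearMap.range (Algebra.algHom ℚ R (MvPolynomial (Fin n) R)).toLinearMap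
  algebraMap_mem q := ⟨algebraMap ℚ R q,
    (Algebra.algHom ℚ R (MvPolynomial (Fin n) R)).commutes q⟩
  exp := (Units.map (MvPolynomial.C : R →+* MvPolynomial (Fin n) R).toMonoidHom).comp
    (E.comp (AddMonoidHom.toMultiplicative
      (LinearEquiv.ofInjective (Algebra.algHom ℚ R (MvPolynomial (Fin n) R)).toLinearMap
        (MvPolynomial.C_injective (Fin n) R)).symm.toLinearMap.toAddMonoidHom))

/-- The E-ring `R[x₁, …, xₙ]^E` of exponential polynomials in `n` variables over `(R, E)`. -/
noncomputable def ExpPoly {R : Type*} [CommRing R] [Algebra ℚ R] (E : Multiplicative R →* Rˣ)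
    (n : ℕ) : PartialERing :=
  (polyERing E n).freeCompletion

/-! Write `R_m` for the stages. Each is a group ring over the factorial ring `K[x̄]` with a
torsion-free exponent group, so it is a decomposition monoid, and so is their union. Hence `f` is
prime.

Take the least `m` such that `f` divides a nonzero element of `R_m`, and let `I = (f) ∩ R_m`, a
prime ideal. It meets the domain of `exp` only in zero: that domain is `R_(m-1)`, or `K` if `m = 0`.
So `I` is trivially an E-ideal.

Prime E-ideals propagate upwards: the quotient of the free 1-extension by the generated E-ideal
embeds in a group ring over `R_m ⧸ I` (`exists_eIdealNext_eq_ker`), which is a domain. The union `P`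
of the resulting chain is the least E-ideal containing `I`, and it is prime. Finally `f`, dividing a
nonzero element of `R_m`, is associated to an element of `R_m` (`exists_eq_ofStage_mul_unit`), so `f
∈ P` and `P` is the E-ideal generated by `f`. -/

/-! ### Factorization in group rings of torsion-free groups. -/

namespace AddMonoidAlgebra

theorem exists_eq_single_of_mul_eq_single {D A : Type*} [Semiring D] [NoZeroDivisors D] [Add A]
    [TwoUniqueSums A] {f g : AddMonoidAlgebra D A} {m : A} {d : D} (hd : d ≠ 0)
    (h : f * g = single m d) : ∃ a c, f = single a c := by
  classical
  have hs : single m d ≠ 0 := fun h0 => hd (by simpa using congrArg coeff h0)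
  have hf : f ≠ 0 := by rintro rfl; rw [zero_mul] at h; exact hs h.symm
  have hg : g ≠ 0 := by rintro rfl; rw [mul_zero] at h; exact hs h.symm
  have hfs : 0 < f.coeff.support.card := by simpa [Finset.card_pos] using hf
  have hgs : 0 < g.coeff.support.card := by simpa [Finset.card_pos] using hg
  by_cases hc : f.coeff.support.card = 1
  · obtain ⟨a, c, -, hac⟩ := Finsupp.card_support_eq_one'.1 hc
    exact ⟨a, c, by rw [← ofCoeff_single, ← hac]⟩
  exfalso
  -- Two distinct pairs have sums attained only once. Nothing cancels there, so both sums equal `m`,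
  -- and uniqueness makes the pairs coincide.
  obtain ⟨p, hp, q, hq, hpq, hpu, hqu⟩ := TwoUniqueSums.uniqueAdd_of_one_lt_card
    (A := f.coeff.support) (B := g.coeff.support)
    (lt_of_lt_of_le (by omega) (Nat.le_mul_of_pos_right _ hgs))
  have key : ∀ r ∈ f.coeff.support ×ˢ g.coeff.support,
      UniqueAdd f.coeff.support g.coeff.support r.1 r.2 → r.1 + r.2 = m := by
    intro r hr hru
    have := coeff_mul_add_of_uniqueAdd hru
    rw [h] at this
    by_contra hne
    rw [coeff_single, Finsupp.single_eq_of_ne hne] at this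
    rw [Finset.mem_product, Finsupp.mem_support_iff, Finsupp.mem_support_iff] at hr
    exact mul_ne_zero hr.1 hr.2 this.symm
  obtain ⟨hq1, hq2⟩ := Finset.mem_product.1 hq
  obtain ⟨h1, h2⟩ := hpu hq1 hq2 ((key q hq hqu).trans (key p hp hpu).symm)
  exact hpq (Prod.ext h1.symm h2.symm)

end AddMonoidAlgebra

/-- The subgroup generated by `F` is free of finite rank. A large multiple `N` of the sum of a basis
makes all coordinates of `N + x` nonnegative. -/
theorem exists_cone_of_finset {B : Type*} [AddCommGroup B] [Module.IsTorsionFree ℤ B]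
    (F : Finset B) : ∃ (k : ℕ) (e : (Fin k →₀ ℕ) →+ B) (N : B), Function.Injective e ∧
      ∀ x ∈ F, N + x ∈ Set.range e := by
  classical
  let H := Submodule.span ℤ (F : Set B)
  have : Module.Finite ℤ H := Module.Finite.span_finset ℤ F
  let b := Module.finBasis ℤ H
  let e : (Fin (Module.finrank ℤ H) →₀ ℕ) →+ B :=
    (H.subtype.toAddMonoidHom.comp b.repr.symm.toLinearMap.toAddMonoidHom).comp
      (Finsupp.mapRange.addMonoidHom (Nat.castAddMonoidHom ℤ))
  have hF : ∀ x ∈ F, x ∈ H := fun x hx => Submodule.subset_span hx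
  obtain ⟨M, hM⟩ : ∃ M : ℕ, ∀ x : F, ∀ i, 0 ≤ (M : ℤ) + b.repr ⟨x, hF x x.2⟩ i := by
    refine ⟨∑ x : F, ∑ i, (b.repr ⟨x, hF x x.2⟩ i).natAbs, fun x i => ?_⟩
    have h1 := Finset.single_le_sum (f := fun i => (b.repr ⟨x, hF x x.2⟩ i).natAbs)
      (fun _ _ => Nat.zero_le _) (Finset.mem_univ i)
    have h2 := Finset.single_le_sum (f := fun x : F => ∑ i, (b.repr ⟨x, hF x x.2⟩ i).natAbs)
      (fun _ _ => Nat.zero_le _) (Finset.mem_univ x)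
    have h3 := h1.trans h2
    omega
  refine ⟨_, e, (b.repr.symm (Finsupp.equivFunOnFinite.symm fun _ => (M : ℤ)) : H), ?_, ?_⟩
  · exact Subtype.val_injective.comp (b.repr.symm.injective.comp
      (Finsupp.mapRange_injective _ (Nat.cast_zero) Nat.cast_injective))
  · intro x hx
    refine ⟨Finsupp.equivFunOnFinite.symm fun i =>
      ((M : ℤ) + b.repr ⟨x, hF x hx⟩ i).toNat, ?_⟩
    have : Finsupp.mapRange.addMonoidHom (Nat.castAddMonoidHom ℤ)
        (Finsupp.equivFunOnFinite.symm fun i => ((M : ℤ) + b.repr ⟨x, hF x hx⟩ i).toNat) =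
        Finsupp.equivFunOnFinite.symm (fun _ => (M : ℤ)) + b.repr ⟨x, hF x hx⟩ := by
      ext i
      have := hM ⟨x, hx⟩ i
      simpa using this
    change ((b.repr.symm (Finsupp.mapRange.addMonoidHom (Nat.castAddMonoidHom ℤ) _) : H) : B) = _
    rw [this, map_add, LinearEquiv.symm_apply_apply]
    rfl

/-- The unit `t^N` moves the four elements of `b * c = a * d` into a copy of a polynomial ring over
`S`, which is factorial. Factoriality itself is lost when `B` is divisible and nonzero: `t^b - 1` is
divisible by `t^(b/2) - 1`, and so on. -/
theorem AddMonoidAlgebra.decompositionMonoid {S B : Type*} [CommRing S] [IsDomain S]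
    [UniqueFactorizationMonoid S] [AddCommGroup B] [Module.IsTorsionFree ℤ B] :
    DecompositionMonoid (AddMonoidAlgebra S B) where
  primal a := by
    classical
    rintro b c ⟨d, hd⟩
    obtain ⟨k, e, N, he, hN⟩ := exists_cone_of_finset
      (a.coeff.support ∪ b.coeff.support ∪ c.coeff.support ∪ d.coeff.support)
    let j : MvPolynomial (Fin k) S →+* AddMonoidAlgebra S B := mapDomainRingHom S e
    have hj : Function.Injective j := mapDomain_injective he
    let u : AddMonoidAlgebra S B := single N 1
    let u' : AddMonoidAlgebra S B := single (-N) 1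
    have huu : u' * u = 1 := by simp [u, u', single_mul_single, one_def]
    have key : ∀ x : AddMonoidAlgebra S B,
        x.coeff.support ⊆
          a.coeff.support ∪ b.coeff.support ∪ c.coeff.support ∪ d.coeff.support →
        ∃ p, j p = u * x := by
      intro x hx
      refine ⟨comapDomain e he (u * x), mapDomain_comapDomain ?_ _⟩
      intro y hy
      have h1 := support_coeff_mul_subset u x hy
      obtain ⟨v, hv, w, hw, rfl⟩ := Finset.mem_add.1 h1
      have hv' : v = N := by simpa using Finsupp.support_single_subset hv
      rw [hv']
      exact hN w (hx hw)
    obtain ⟨a', ha⟩ := key a (by intro; simp +contextual)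
    obtain ⟨b', hb⟩ := key b (by intro; simp +contextual)
    obtain ⟨c', hc⟩ := key c (by intro; simp +contextual)
    obtain ⟨d', hd'⟩ := key d (by intro; simp +contextual)
    have h : b' * c' = a' * d' := hj (by
      rw [map_mul, map_mul, ha, hb, hc, hd', mul_mul_mul_comm, hd, mul_mul_mul_comm])
    obtain ⟨p, q, hp, hq, rfl⟩ := exists_dvd_and_dvd_of_dvd_mul (Dvd.intro _ h.symm)
    have hb1 : b = u' * j b' := by rw [hb, ← mul_assoc, huu, one_mul]
    have hc1 : c = u' * j c' := by rw [hc, ← mul_assoc, huu, one_mul]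
    have ha1 : a = u' * j (p * q) := by rw [ha, ← mul_assoc, huu, one_mul]
    -- The product `p * q` carries a single shift, so only one factor is shifted back.
    refine ⟨u' * j p, j q, ?_, ?_, ?_⟩
    · rw [hb1]; exact mul_dvd_mul_left _ (map_dvd j hp)
    · rw [hc1]; exact (map_dvd j hq).mul_left _
    · rw [ha1, map_mul, mul_assoc]

namespace PartialERing

/-! ### Universal property of the free 1-extension. -/

section FreeExt

variable (D : PartialERing)

theorem incl_injective : Function.Injective D.incl :=
  AddMonoidAlgebra.single_right_injective

theorem expNext_compl (a : D.compl) :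
    (D.expNext (Multiplicative.ofAdd (a : D)) : D.freeExt) =
      (AddMonoidAlgebra.single a 1 : AddMonoidAlgebra D D.compl) := by
  have h1 : D.dom.projectionOnto D.compl D.isCompl_compl (a : D) = 0 :=
    Submodule.projectionOnto_apply_right _ _
  have h2 : D.compl.projectionOnto D.dom D.isCompl_compl.symm (a : D) = a :=
    Submodule.projectionOnto_apply_left _ _
  change ((Units.map (AddMonoidAlgebra.singleZeroAlgHom (R := ℚ) (A := D) (M := D.compl) :
        D →* AddMonoidAlgebra D D.compl) (D.exp (Multiplicative.ofAdd
        (D.dom.projectionOnto D.compl D.isCompl_compl (a : D)))) *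
    (AddMonoidAlgebra.of D D.compl).toHomUnits (Multiplicative.ofAdd
      (D.compl.projectionOnto D.dom D.isCompl_compl.symm (a : D))) :
      (AddMonoidAlgebra D D.compl)ˣ) : AddMonoidAlgebra D D.compl) = _
  rw [h1, h2, ofAdd_zero, map_one, map_one, one_mul]
  rfl

theorem expNext_of_mem' (v : D.dom) :
    (D.expNext (Multiplicative.ofAdd (v : D)) : D.freeExt) =
      D.incl (D.exp (Multiplicative.ofAdd v) : D) :=
  congrArg Units.val (D.expNext_of_mem v)

/-- Every element of `D` is the sum of an element of the domain and one of the complement. -/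
theorem exists_dom_add_compl (x : D) : ∃ (v : D.dom) (a : D.compl), (v : D) + a = x := by
  obtain ⟨v, hv, a, ha, h⟩ := Submodule.mem_sup.1
    (D.isCompl_compl.sup_eq_top ▸ Submodule.mem_top : x ∈ D.dom ⊔ D.compl)
  exact ⟨⟨v, hv⟩, ⟨a, ha⟩, h⟩

theorem expNext_add (x y : D) : (D.expNext (Multiplicative.ofAdd (x + y)) : D.freeExt) =
    D.expNext (Multiplicative.ofAdd x) * D.expNext (Multiplicative.ofAdd y) := by
  rw [ofAdd_add, map_mul, Units.val_mul]

variable {D}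

/-- Ring homomorphisms out of the free 1-extension are determined on `D` and on exponentials. -/
theorem freeExt_ringHom_ext {X : Type*} [Semiring X] {φ ψ : D.freeExt →+* X}
    (h : ∀ x, φ (D.incl x) = ψ (D.incl x))
    (h' : ∀ x, φ (D.expNext (Multiplicative.ofAdd x)) = ψ (D.expNext (Multiplicative.ofAdd x))) :
    φ = ψ :=
  AddMonoidAlgebra.ringHom_ext (R := D) (M := D.compl) h fun a => by
    rw [← D.expNext_compl a]
    exact h' a

/-- The universal property of the free 1-extension. -/
theorem exists_freeExt_lift {X : Type*} [CommSemiring X] (φ : D →+* X)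
    (χ : Multiplicative D →* X)
    (h : ∀ v : D.dom, χ (Multiplicative.ofAdd (v : D)) = φ (D.exp (Multiplicative.ofAdd v) : D)) :
    ∃ ψ : D.freeExt →+* X, (∀ x, ψ (D.incl x) = φ x) ∧
      ∀ x, ψ (D.expNext (Multiplicative.ofAdd x)) = χ (Multiplicative.ofAdd x) := by
  let ψ : AddMonoidAlgebra D D.compl →+* X := AddMonoidAlgebra.liftNCRingHom φ
    (χ.comp (AddMonoidHom.toMultiplicative D.compl.subtype.toAddMonoidHom))
    fun _ _ => Commute.all _ _
  have h1 : ∀ x, ψ (AddMonoidAlgebra.single 0 x) = φ x := fun x => by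
    refine (AddMonoidAlgebra.liftNCRingHom_single _ _ _ _ _).trans ?_
    rw [ofAdd_zero, map_one, mul_one]
  have h2 : ∀ a : D.compl,
      ψ (AddMonoidAlgebra.single a 1) = χ (Multiplicative.ofAdd (a : D)) := fun a => by
    refine (AddMonoidAlgebra.liftNCRingHom_single _ _ _ _ _).trans ?_
    rw [map_one, one_mul]
    rfl
  let ψ' : D.freeExt →+* X := ψ
  refine ⟨ψ', h1, fun x => ?_⟩
  obtain ⟨v, a, rfl⟩ := D.exists_dom_add_compl x
  rw [expNext_add, map_mul, expNext_of_mem', expNext_compl, ofAdd_add, map_mul, h]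
  exact congrArg₂ _ (h1 _) (h2 a)

end FreeExt

/-! ### Extending E-ideals to the free 1-extension. -/

section EIdealNext

variable (D : PartialERing) (I : Ideal D)

/-- The ideal of the free 1-extension of `D` generated by `I` and by `exp x - 1` for `x ∈ I`. -/
noncomputable def eIdealNext : Ideal D.freeExt :=
  Ideal.span (D.incl '' I) ⊔
    Ideal.span ((fun x => (D.expNext (Multiplicative.ofAdd x) : D.freeExt) - 1) '' I)

variable {D I}

theorem incl_mem_eIdealNext {x : D} (hx : x ∈ I) : D.incl x ∈ D.eIdealNext I :=
  Ideal.mem_sup_left (Ideal.subset_span ⟨x, hx, rfl⟩)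

theorem expNext_sub_one_mem_eIdealNext {x : D} (hx : x ∈ I) :
    (D.expNext (Multiplicative.ofAdd x) : D.freeExt) - 1 ∈ D.eIdealNext I :=
  Ideal.mem_sup_right (Ideal.subset_span ⟨x, hx, rfl⟩)

theorem eIdealNext_le {J : Ideal D.freeExt} (h : ∀ x ∈ I, D.incl x ∈ J)
    (h' : ∀ x ∈ I, (D.expNext (Multiplicative.ofAdd x) : D.freeExt) - 1 ∈ J) :
    D.eIdealNext I ≤ J := by
  refine sup_le (Ideal.span_le.2 ?_) (Ideal.span_le.2 ?_)
  · rintro _ ⟨x, hx, rfl⟩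
    exact h x hx
  · rintro _ ⟨x, hx, rfl⟩
    exact h' x hx

theorem mk_expNext_congr {x y : D} (h : x - y ∈ I) :
    Ideal.Quotient.mk (D.eIdealNext I) (D.expNext (Multiplicative.ofAdd x)) =
      Ideal.Quotient.mk (D.eIdealNext I) (D.expNext (Multiplicative.ofAdd y)) := by
  rw [Ideal.Quotient.eq]
  have := (D.eIdealNext I).mul_mem_left (D.expNext (Multiplicative.ofAdd y))
    (expNext_sub_one_mem_eIdealNext h)
  rwa [mul_sub, mul_one, ← expNext_add, add_sub_cancel] at this

/-- `C` is a complement of the image of the domain in `D ⧸ I`, and `S` lifts the domain part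
linearly. Such a lift is determined only modulo `I`, which is harmless for an E-ideal by
`mk_exp_congr`. -/
theorem exists_quotient_splitting (I : Ideal D) :
    ∃ (C : Submodule ℚ (D ⧸ I)) (S : (D ⧸ I) →ₗ[ℚ] D.dom × C),
      (∀ y, Ideal.Quotient.mk I (S y).1 + (S y).2 = y) ∧
      (∀ v : D.dom, ((S (Ideal.Quotient.mk I v)).1 : D) - v ∈ I ∧
        (S (Ideal.Quotient.mk I v)).2 = 0) ∧
      (∀ c : C, ((S c).1 : D) ∈ I ∧ (S c).2 = c) := by
  let π : D →ₗ[ℚ] (D ⧸ I) := (Ideal.Quotient.mkₐ ℚ I).toLinearMap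
  obtain ⟨C, hC⟩ := Submodule.exists_isCompl (D.dom.map π)
  let T : (D.dom × C) →ₗ[ℚ] (D ⧸ I) := (π.comp D.dom.subtype).coprod C.subtype
  have hT : Function.Surjective T := by
    intro y
    obtain ⟨_, ⟨v, hv, rfl⟩, c, hc, h⟩ := Submodule.mem_sup.1
      (hC.sup_eq_top ▸ Submodule.mem_top : y ∈ D.dom.map π ⊔ C)
    exact ⟨(⟨v, hv⟩, ⟨c, hc⟩), h⟩
  obtain ⟨S, hS⟩ := T.exists_rightInverse_of_surjective (LinearMap.range_eq_top.2 hT)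
  have hS' : ∀ y, π (S y).1 + (S y).2 = y := fun y => LinearMap.congr_fun hS y
  have uniq : ∀ (v : D.dom) (c : C), π v + c = 0 → (v : D) ∈ I ∧ c = 0 := by
    intro v c h
    have hc : (c : D ⧸ I) ∈ D.dom.map π :=
      ⟨-v, neg_mem v.2, by rw [map_neg]; exact neg_eq_of_add_eq_zero_right h⟩
    have hc0 : (c : D ⧸ I) = 0 := Submodule.disjoint_def.1 hC.disjoint _ hc c.2
    rw [hc0, add_zero] at h
    exact ⟨Ideal.Quotient.eq_zero_iff_mem.1 h, Subtype.ext hc0⟩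
  refine ⟨C, S, hS', fun v => ?_, fun c => ?_⟩
  · refine uniq ((S (π v)).1 - v) (S (π v)).2 ?_
    rw [Submodule.coe_sub, map_sub, sub_add_eq_add_sub, hS', sub_self]
  · have := uniq (S c).1 ((S c).2 - c)
      (by rw [Submodule.coe_sub, ← add_sub_assoc, hS', sub_self])
    exact ⟨this.1, sub_eq_zero.1 this.2⟩

theorem mk_exp_congr (hI : D.IsEIdeal I) {v w : D.dom} (h : (v : D) - w ∈ I) :
    Ideal.Quotient.mk I (D.exp (Multiplicative.ofAdd v) : D) =
      Ideal.Quotient.mk I (D.exp (Multiplicative.ofAdd w) : D) := by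
  rw [Ideal.Quotient.eq]
  have := I.mul_mem_left (D.exp (Multiplicative.ofAdd w) : D) (hI (v - w) h)
  rwa [mul_sub, mul_one, ← Units.val_mul, ← map_mul, ← ofAdd_add, add_sub_cancel] at this

/-- The quotient of the free 1-extension of `D` by the E-ideal generated by a prime E-ideal `I`
embeds in a group ring over `D ⧸ I`. -/
theorem exists_eIdealNext_eq_ker (hI : D.IsEIdeal I) :
    ∃ (C : Submodule ℚ (D ⧸ I)) (φ : D.freeExt →+* AddMonoidAlgebra (D ⧸ I) C),
      (∀ x, φ (D.incl x) = AddMonoidAlgebra.single 0 (Ideal.Quotient.mk I x)) ∧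
      D.eIdealNext I = RingHom.ker φ := by
  obtain ⟨C, S, hS, hSv, hSc⟩ := exists_quotient_splitting I
  -- This is the exponential of the free 1-extension of `D ⧸ I`, pulled back to `D`; linearity of
  -- `S` makes it multiplicative.
  let χ : Multiplicative D →* AddMonoidAlgebra (D ⧸ I) C :=
    { toFun := fun x => AddMonoidAlgebra.single (S (Ideal.Quotient.mk I x.toAdd)).2
        (Ideal.Quotient.mk I
          (D.exp (Multiplicative.ofAdd (S (Ideal.Quotient.mk I x.toAdd)).1) : D))
      map_one' := by simp [AddMonoidAlgebra.one_def]
      map_mul' := fun x y => by simp [AddMonoidAlgebra.single_mul_single] }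
  obtain ⟨φ, hφ, hφe⟩ := exists_freeExt_lift
    (AddMonoidAlgebra.singleZeroRingHom.comp (Ideal.Quotient.mk I)) χ (fun v => by
      obtain ⟨h1, h2⟩ := hSv v
      change AddMonoidAlgebra.single _ _ = AddMonoidAlgebra.single 0 _
      rw [toAdd_ofAdd, h2, mk_exp_congr hI h1])
  refine ⟨C, φ, hφ, le_antisymm (eIdealNext_le (fun x hx => ?_) fun x hx => ?_) ?_⟩
  · rw [RingHom.mem_ker, hφ, RingHom.comp_apply, Ideal.Quotient.eq_zero_iff_mem.2 hx, map_zero]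
  · rw [RingHom.mem_ker, map_sub, map_one, hφe, sub_eq_zero]
    change AddMonoidAlgebra.single (S (Ideal.Quotient.mk I x)).2 (Ideal.Quotient.mk I
      (D.exp (Multiplicative.ofAdd (S (Ideal.Quotient.mk I x)).1) : D)) = _
    rw [Ideal.Quotient.eq_zero_iff_mem.2 hx, map_zero, Prod.fst_zero, Prod.snd_zero, ofAdd_zero,
      map_one, Units.val_one, map_one]
    rfl
  -- For `ker φ ≤ eIdealNext I`, the quotient map `q` is factored through `φ`. The map `ψ` back
  -- sends `t^c` to the class of `exp (σ c)`, with `σ` a linear section.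
  · obtain ⟨σ, hσ⟩ := (Ideal.Quotient.mkₐ ℚ I).toLinearMap.exists_rightInverse_of_surjective
      (LinearMap.range_eq_top.2 Ideal.Quotient.mk_surjective)
    have hσ' : ∀ y, Ideal.Quotient.mk I (σ y) = y := fun y => LinearMap.congr_fun hσ y
    let q := Ideal.Quotient.mk (D.eIdealNext I)
    let ψ : AddMonoidAlgebra (D ⧸ I) C →+* D.freeExt ⧸ D.eIdealNext I :=
      AddMonoidAlgebra.liftNCRingHom
        (Ideal.Quotient.lift I (q.comp (D.incl : D →+* D.freeExt)) fun x hx =>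
          Ideal.Quotient.eq_zero_iff_mem.2 (incl_mem_eIdealNext hx))
        ((q : D.freeExt →* _).comp ((Units.coeHom D.freeExt).comp (D.expNext.comp
          (AddMonoidHom.toMultiplicative (σ.comp C.subtype).toAddMonoidHom))))
        fun _ _ => Commute.all _ _
    have hψ : ∀ x c, ψ (AddMonoidAlgebra.single c (Ideal.Quotient.mk I x)) =
        q (D.incl x) * q (D.expNext (Multiplicative.ofAdd (σ c))) :=
      fun x c => AddMonoidAlgebra.liftNCRingHom_single _ _ _ _ _
    have hcomp : ψ.comp φ = q := by
      refine freeExt_ringHom_ext (fun x => ?_) fun x => ?_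
      · rw [RingHom.comp_apply, hφ]
        refine (hψ x 0).trans ?_
        rw [Submodule.coe_zero, map_zero, ofAdd_zero, map_one, Units.val_one, map_one, mul_one]
      · rw [RingHom.comp_apply, hφe]
        refine (hψ _ _).trans ?_
        rw [← expNext_of_mem', ← map_mul, ← expNext_add]
        refine mk_expNext_congr ?_
        rw [← Ideal.Quotient.eq, map_add, hσ', hS]
        rfl
    intro x hx
    rw [← Ideal.Quotient.eq_zero_iff_mem]
    change q x = 0
    rw [← hcomp, RingHom.comp_apply, (RingHom.mem_ker).1 hx, map_zero]

/-- A group ring over the domain `D ⧸ I` with exponents in a `ℚ`-vector space is a domain. -/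
theorem isPrime_eIdealNext [hp : I.IsPrime] (hI : D.IsEIdeal I) : (D.eIdealNext I).IsPrime := by
  obtain ⟨C, φ, -, h⟩ := exists_eIdealNext_eq_ker hI
  rw [h]
  exact RingHom.ker_isPrime φ

theorem incl_mem_eIdealNext_iff (hI : D.IsEIdeal I) {x : D} :
    D.incl x ∈ D.eIdealNext I ↔ x ∈ I := by
  obtain ⟨C, φ, hφ, h⟩ := exists_eIdealNext_eq_ker hI
  rw [h, RingHom.mem_ker, hφ, AddMonoidAlgebra.single_eq_zero, Ideal.Quotient.eq_zero_iff_mem]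

theorem isEIdeal_eIdealNext (hI : D.IsEIdeal I) : D.freeExt.IsEIdeal (D.eIdealNext I) := by
  -- The domain of the new exponential is `D`, so only elements of `I` have to be tested.
  rintro ⟨_, x, rfl⟩ hx
  have hx' : x ∈ I := (incl_mem_eIdealNext_iff hI).1 hx
  have := expNext_sub_one_mem_eIdealNext hx'
  rw [← D.exp_freeExt x] at this
  exact this

end EIdealNext

universe u

variable (D : PartialERing.{u})

/-! ### The stages and their union. -/

section Stages

theorem trans_injective (m n : ℕ) (h : m ≤ n) : Function.Injective (D.trans m n h) := by
  induction n, h using Nat.le_induction with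
  | base => rw [trans_self]; exact Function.injective_id
  | succ n hn ih =>
    rw [trans_succ _ _ _ hn]
    exact (D.stage n).incl_injective.comp ih

theorem ofStage_injective (n : ℕ) : Function.Injective (D.ofStage n) := by
  intro x y h
  obtain ⟨k, hx, hy, e⟩ := Quotient.exact h
  exact D.trans_injective n k hx e

theorem exists_ofStage (m : ℕ) (x : D.union) : ∃ k y, D.ofStage (m + k) y = x := by
  induction x using DirectLimit.induction with
  | _ i x => exact ⟨i, D.trans i (m + i) (Nat.le_add_left i m) x, D.ofStage_trans _ _ _ x⟩

theorem exists_ofStage₂ (m : ℕ) (x y : D.union) :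
    ∃ k a b, D.ofStage (m + k) a = x ∧ D.ofStage (m + k) b = y := by
  obtain ⟨i, a, rfl⟩ := D.exists_ofStage m x
  obtain ⟨j, b, rfl⟩ := D.exists_ofStage m y
  exact ⟨i + j, D.trans _ _ (by omega) a, D.trans _ _ (by omega) b,
    D.ofStage_trans _ _ _ a, D.ofStage_trans _ _ _ b⟩

/-- The inclusion of the free 1-extension of the `n`-th stage in the union. -/
noncomputable def ofFreeExt (n : ℕ) : (D.stage n).freeExt →+* D.union := D.ofStage (n + 1)

theorem ofFreeExt_incl (n : ℕ) (x : D.stage n) :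
    D.ofFreeExt n ((D.stage n).incl x) = D.ofStage n x :=
  D.ofStage_incl n x

theorem isDomain_union (h : ∀ n, IsDomain (D.stage n)) : IsDomain D.union := by
  have : Nontrivial D.union := (D.ofStage_injective 0).nontrivial
  have : NoZeroDivisors D.union := ⟨by
    intro x y hxy
    obtain ⟨k, a, b, rfl, rfl⟩ := D.exists_ofStage₂ 0 x y
    rw [← map_mul, map_eq_zero_iff _ (D.ofStage_injective _), mul_eq_zero] at hxy
    exact hxy.imp (fun h => by rw [h, map_zero]) fun h => by rw [h, map_zero]⟩
  exact NoZeroDivisors.to_isDomain _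

theorem decompositionMonoid_union (h : ∀ n, DecompositionMonoid (D.stage n)) :
    DecompositionMonoid D.union where
  primal a := by
    rintro b c ⟨d, hd⟩
    obtain ⟨i, a, d, rfl, rfl⟩ := D.exists_ofStage₂ 0 a d
    obtain ⟨j, b, c, rfl, rfl⟩ := D.exists_ofStage₂ (0 + i) b c
    rw [← D.ofStage_trans _ (0 + i + j) (Nat.le_add_right _ _) a,
      ← D.ofStage_trans _ (0 + i + j) (Nat.le_add_right _ _) d, ← map_mul, ← map_mul] at hd
    have hd := D.ofStage_injective _ hd
    obtain ⟨p, q, hp, hq, e⟩ := exists_dvd_and_dvd_of_dvd_mul (Dvd.intro _ hd.symm)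
    refine ⟨D.ofStage _ p, D.ofStage _ q, map_dvd _ hp, map_dvd _ hq, ?_⟩
    rw [← map_mul, ← e, D.ofStage_trans]

theorem isDomain_stage [IsDomain D] (n : ℕ) : IsDomain (D.stage n) := by
  induction n with
  | zero => assumption
  | succ n ih =>
    exact inferInstanceAs (IsDomain (AddMonoidAlgebra (D.stage n) (D.stage n).compl))

/-- The stages of the canonical filtration are group rings over the initial ring. -/
theorem exists_stage_ringEquiv (n : ℕ) :
    ∃ (B : Type u) (_ : AddCommGroup B) (_ : Module ℚ B),
      Nonempty (D.stage n ≃+* AddMonoidAlgebra D B) := by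
  induction n with
  | zero =>
    let e : D ≃+* AddMonoidAlgebra D (⊥ : Submodule ℚ D) :=
      RingEquiv.ofBijective AddMonoidAlgebra.singleZeroRingHom
        ⟨AddMonoidAlgebra.single_right_injective, fun x => ⟨x.coeff 0, by
          refine AddMonoidAlgebra.ext (Finsupp.ext fun a => ?_)
          rw [Subsingleton.elim a 0]
          exact Finsupp.single_eq_same⟩⟩
    exact ⟨(⊥ : Submodule ℚ D), inferInstance, inferInstance, ⟨e⟩⟩
  | succ n ih =>
    obtain ⟨B, _, _, ⟨e⟩⟩ := ih
    let e₁ : (D.stage n).freeExt ≃+* AddMonoidAlgebra (AddMonoidAlgebra D B) (D.stage n).compl :=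
      AddMonoidAlgebra.mapRingEquiv _ e
    exact ⟨(D.stage n).compl × B, inferInstance, inferInstance,
      ⟨e₁.trans AddMonoidAlgebra.curryRingEquiv.symm⟩⟩

/-- Induction on stages would need factorial coefficients at each step; collapsing the stage to one
group ring over `D` avoids this. -/
theorem decompositionMonoid_stage [IsDomain D] [UniqueFactorizationMonoid D] (n : ℕ) :
    DecompositionMonoid (D.stage n) := by
  obtain ⟨B, _, _, ⟨e⟩⟩ := D.exists_stage_ringEquiv n
  have : Module.IsTorsionFree ℤ B := .trans_faithfulSMul ℤ ℚ B
  have := AddMonoidAlgebra.decompositionMonoid (S := D) (B := B)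
  exact MulEquiv.decompositionMonoid e

end Stages

/-! ### The E-ideal of the union generated by an E-ideal of a stage. -/

section Chain

variable {D} {m : ℕ} (I : Ideal (D.stage m))

/-- The chain of E-ideals of the later stages generated by an ideal of the `m`-th stage. -/
noncomputable def eIdealChain : ∀ k, Ideal (D.stage (m + k))
  | 0 => I
  | k + 1 => (D.stage (m + k)).eIdealNext (eIdealChain k)

variable {I}

theorem isEIdeal_eIdealChain (hI : (D.stage m).IsEIdeal I) (k : ℕ) :
    (D.stage (m + k)).IsEIdeal (eIdealChain I k) := by
  induction k with
  | zero => exact hI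
  | succ k ih => exact isEIdeal_eIdealNext ih

theorem isPrime_eIdealChain [hp : I.IsPrime] (hI : (D.stage m).IsEIdeal I) (k : ℕ) :
    (eIdealChain I k).IsPrime := by
  induction k with
  | zero => exact hp
  | succ k ih => exact isPrime_eIdealNext (isEIdeal_eIdealChain hI k)

theorem trans_mem_eIdealChain_iff (hI : (D.stage m).IsEIdeal I) {j k : ℕ} (h : j ≤ k)
    (x : D.stage (m + j)) :
    D.trans (m + j) (m + k) (Nat.add_le_add_left h m) x ∈ eIdealChain I k ↔
      x ∈ eIdealChain I j := by
  induction k, h using Nat.le_induction with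
  | base => rw [trans_self]; rfl
  | succ k hk ih =>
    have h := D.trans_succ (m + j) (m + k) (Nat.add_le_add_left hk m)
    refine Iff.trans ?_ ih
    refine Iff.trans ?_ (incl_mem_eIdealNext_iff (isEIdeal_eIdealChain hI k))
    exact iff_of_eq (congrArg (· ∈ eIdealChain I (k + 1)) (DFunLike.congr_fun h x))

/-- A prime E-ideal of a stage generates a prime ideal of the union that is closed under
the exponential map. -/
theorem exists_prime_eIdeal_union [hp : I.IsPrime] (hI : (D.stage m).IsEIdeal I) :
    ∃ P : Ideal D.union, P.IsPrime ∧ D.freeCompletion.IsEIdeal P ∧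
      (∀ x ∈ I, D.ofStage m x ∈ P) ∧
      ∀ Q : Ideal D.union, D.freeCompletion.IsEIdeal Q → (∀ x ∈ I, D.ofStage m x ∈ Q) → P ≤ Q := by
  let S : Set D.union := {x | ∃ k, ∃ y ∈ eIdealChain I k, D.ofStage (m + k) y = x}
  -- The union cuts out exactly the `k`-th ideal of the chain at stage `m + k`, so primality can be
  -- checked stage by stage.
  have hS : ∀ k y, D.ofStage (m + k) y ∈ S ↔ y ∈ eIdealChain I k := by
    refine fun k y => ⟨?_, fun h => ⟨k, y, h, rfl⟩⟩
    rintro ⟨j, z, hz, h⟩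
    rw [← trans_mem_eIdealChain_iff hI (le_max_left k j)]
    rw [← trans_mem_eIdealChain_iff hI (le_max_right k j)] at hz
    convert hz using 1
    apply D.ofStage_injective
    rw [D.ofStage_trans, D.ofStage_trans, h]
  let P : Ideal D.union :=
    { carrier := S
      add_mem' := fun {x y} hx hy => by
        obtain ⟨k, a, b, rfl, rfl⟩ := D.exists_ofStage₂ m x y
        rw [← map_add, hS]
        exact add_mem ((hS _ _).1 hx) ((hS _ _).1 hy)
      zero_mem' := ⟨0, 0, zero_mem _, map_zero _⟩
      smul_mem' := fun x y hy => by
        obtain ⟨k, a, b, rfl, rfl⟩ := D.exists_ofStage₂ m x y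
        rw [smul_eq_mul, ← map_mul, hS]
        exact Ideal.mul_mem_left _ _ ((hS _ _).1 hy) }
  have hP : ∀ k y, D.ofStage (m + k) y ∈ P ↔ y ∈ eIdealChain I k := hS
  refine ⟨P, ⟨?_, ?_⟩, ?_, fun x hx => (hP 0 x).2 hx, fun Q hQ hIQ => ?_⟩
  · rw [Ideal.ne_top_iff_one, ← map_one (D.ofStage (m + 0)), hP]
    exact (Ideal.ne_top_iff_one _).1 hp.ne_top
  · intro x y hxy
    obtain ⟨k, a, b, rfl, rfl⟩ := D.exists_ofStage₂ m x y
    rw [← map_mul, hP] at hxy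
    rw [hP, hP]
    exact (isPrime_eIdealChain hI k).mem_or_mem hxy
  · rintro ⟨x, -⟩ (hx : x ∈ P)
    obtain ⟨k, y, rfl⟩ := D.exists_ofStage m x
    -- The exponential of an element of stage `m + k` lives one stage higher.
    have h : D.ofFreeExt (m + k) _ ∈ P :=
      (hP (k + 1) _).2 (expNext_sub_one_mem_eIdealNext ((hP k y).1 hx))
    rw [map_sub, map_one] at h
    exact h
  · suffices h : ∀ k, ∀ y ∈ eIdealChain I k, D.ofStage (m + k) y ∈ Q by
      rintro _ ⟨k, y, hy, rfl⟩
      exact h k y hy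
    intro k
    induction k with
    | zero => exact hIQ
    | succ k ih =>
      refine eIdealNext_le (J := Q.comap (D.ofFreeExt (m + k))) (fun x hx => ?_) fun x hx => ?_
      · rw [Ideal.mem_comap, D.ofFreeExt_incl]
        exact ih x hx
      · rw [Ideal.mem_comap, map_sub, map_one]
        exact hQ ⟨D.ofStage (m + k) x, trivial⟩ (ih x hx)

end Chain

/-! ### Divisors of elements of a stage. -/

section Descent

variable {D}

theorem isUnit_single_one {A : Submodule ℚ D} (a : A) :
    IsUnit (AddMonoidAlgebra.single a 1 : AddMonoidAlgebra D A) :=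
  (AddMonoidAlgebra.of D A).toHomUnits (Multiplicative.ofAdd a) |>.isUnit

/-- The factors of an element of `D` in its free 1-extension are associated to elements of `D`. -/
theorem exists_eq_incl_mul_unit [IsDomain D] {f g : D.freeExt} {d : D} (hd : d ≠ 0)
    (h : f * g = D.incl d) :
    ∃ (c c' : D) (u u' : D.freeExtˣ), c * c' = d ∧ f = D.incl c * u ∧ g = D.incl c' * u' := by
  obtain ⟨a, c, hf⟩ := AddMonoidAlgebra.exists_eq_single_of_mul_eq_single
    (f := (f : AddMonoidAlgebra D D.compl)) (g := g) hd h
  obtain ⟨a', c', hg⟩ := AddMonoidAlgebra.exists_eq_single_of_mul_eq_single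
    (f := (g : AddMonoidAlgebra D D.compl)) (g := f) hd ((mul_comm g f).trans h)
  have h1 : (AddMonoidAlgebra.single a c * AddMonoidAlgebra.single a' c' :
      AddMonoidAlgebra D D.compl) = AddMonoidAlgebra.single 0 d := by
    rw [← hf, ← hg]; exact h
  rw [AddMonoidAlgebra.single_mul_single, AddMonoidAlgebra.single_inj] at h1
  have key : ∀ (b : D.compl) (x : D), (AddMonoidAlgebra.single b x : AddMonoidAlgebra D D.compl) =
      AddMonoidAlgebra.single 0 x * AddMonoidAlgebra.single b 1 := fun b x => by
    rw [AddMonoidAlgebra.single_mul_single, zero_add, mul_one]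
  exact ⟨c, c', (isUnit_single_one a).unit, (isUnit_single_one a').unit,
    h1.elim And.right fun h => absurd h.2 hd, hf.trans (key a c), hg.trans (key a' c')⟩

/-- A factorization descends one stage at a time, up to units. The cofactor descends too, so that
the induction hypothesis applies to `c * c'`. -/
theorem exists_eq_ofStage_mul_unit [IsDomain D] {m : ℕ} {x : D.stage m} (hx : x ≠ 0) {f g : D.union}
    (h : f * g = D.ofStage m x) : ∃ (z : D.stage m) (u : D.unionˣ), f = D.ofStage m z * u := by
  obtain ⟨k, a, b, rfl, rfl⟩ := D.exists_ofStage₂ m f g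
  induction k with
  | zero => exact ⟨a, 1, (mul_one _).symm⟩
  | succ k ih =>
    have := D.isDomain_stage (m + k)
    have hm : m ≤ m + k := Nat.le_add_right m k
    obtain ⟨c, c', u, u', hc, ha, -⟩ := exists_eq_incl_mul_unit
      (D := D.stage (m + k)) (f := a) (g := b) (d := D.trans m (m + k) hm x)
      ((map_ne_zero_iff _ (D.trans_injective _ _ hm)).2 hx) (by
        apply D.ofStage_injective (m + k + 1)
        rw [D.ofStage_incl, D.ofStage_trans, ← h]
        exact map_mul _ _ _)
    obtain ⟨z, w, hz⟩ := ih c c' (by rw [← map_mul, hc, D.ofStage_trans])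
    refine ⟨z, w * Units.map (D.ofFreeExt (m + k) : _ →* D.union) u, ?_⟩
    rw [Units.val_mul, ← mul_assoc, ← hz, ← D.ofFreeExt_incl (m + k) c]
    exact (congrArg (D.ofFreeExt (m + k)) ha).trans (map_mul _ _ _)

end Descent

/-! ### The prime E-ideal generated by an irreducible element. -/

/-- If nonzero elements of the domain of `exp` are units and `D` is a factorial domain, then
irreducible elements of the free completion generate prime E-ideals. -/
theorem isPrimeEIdeal_eSpan_singleton [IsDomain D] [UniqueFactorizationMonoid D]
    (hD : ∀ v ∈ D.dom, v ≠ 0 → IsUnit v) {f : D.freeCompletion} (hf : Irreducible f) :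
    D.freeCompletion.IsPrimeEIdeal (D.freeCompletion.eSpan {f}) := by
  classical
  have : IsDomain D.union := D.isDomain_union D.isDomain_stage
  have : DecompositionMonoid D.union := D.decompositionMonoid_union D.decompositionMonoid_stage
  let f' : D.union := f
  have hf' : Prime f' := Irreducible.prime (M := D.union) hf
  have hex : ∃ m, ∃ x : D.stage m, x ≠ 0 ∧ f' ∣ D.ofStage m x := by
    obtain ⟨k, y, hy⟩ := D.exists_ofStage 0 f'
    refine ⟨0 + k, y, ?_, hy ▸ dvd_rfl⟩
    rintro rfl
    exact hf'.ne_zero (hy.symm.trans (map_zero _))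
  obtain ⟨x, hx, g, hg⟩ := Nat.find_spec hex
  have hmin : ∀ k < Nat.find hex, ∀ x : D.stage k, f' ∣ D.ofStage k x → x = 0 :=
    fun k hk x h => by_contra fun h0 => Nat.find_min hex hk ⟨x, h0, h⟩
  generalize Nat.find hex = m at x hmin
  let I : Ideal (D.stage m) := (Ideal.span {f'}).comap (D.ofStage m)
  have hmem : ∀ y, y ∈ I ↔ f' ∣ D.ofStage m y := fun y => Ideal.mem_span_singleton
  have : (Ideal.span {f'}).IsPrime := (Ideal.span_singleton_prime hf'.ne_zero).2 hf'
  have : I.IsPrime := Ideal.comap_isPrime _ _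
  -- At stage `0` a nonzero `v` would be a unit divisible by `f'`. At stage `m + 1` the domain is
  -- the previous stage, where minimality applies.
  have hdom : ∀ v ∈ (D.stage m).dom, v ∈ I → v = 0 := by
    intro v hv hvI
    rw [hmem] at hvI
    cases m with
    | zero =>
      by_contra h0
      exact hf'.not_isUnit (isUnit_of_dvd_unit hvI ((hD v hv h0).map (D.ofStage 0)))
    | succ m =>
      obtain ⟨y, rfl⟩ := hv
      have := hmin m m.lt_succ_self y (by rw [← D.ofStage_incl]; exact hvI)
      rw [this]
      exact map_zero _
  have hI : (D.stage m).IsEIdeal I := by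
    intro v hv
    have : v = 0 := Subtype.ext (hdom v v.2 hv)
    rw [this, ofAdd_zero, map_one, Units.val_one, sub_self]
    exact zero_mem _
  obtain ⟨P, hP, hPE, hIP, hPmin⟩ := exists_prime_eIdeal_union hI
  obtain ⟨z, u, hz⟩ := exists_eq_ofStage_mul_unit hx hg.symm
  have hfP : f' ∈ P := by
    rw [hz]
    refine P.mul_mem_right _ (hIP z ((hmem z).2 ⟨↑u⁻¹, ?_⟩))
    rw [hz, Units.mul_inv_cancel_right]
  have heq : D.freeCompletion.eSpan {f} = P := by
    refine le_antisymm (sInf_le ⟨hPE, Set.singleton_subset_iff.2 hfP⟩) (le_sInf ?_)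
    -- Elements of `I` are multiples of `f'`, so every E-ideal containing `f` contains `I`, hence
    -- `P`.
    rintro Q ⟨hQ, hfQ⟩
    exact hPmin Q hQ fun y hy =>
      Ideal.mem_of_dvd Q ((hmem y).1 hy) (Set.singleton_subset_iff.1 hfQ)
  exact ⟨isEIdeal_eSpan _ _, heq ▸ hP⟩

end PartialERing

theorem mainTheorem6 {K : Type*} [Field K] [CharZero K] (E : Multiplicative K →* Kˣ) (n : ℕ)
    (f : ExpPoly E n) (hf : Irreducible f) :
    (ExpPoly E n).IsPrimeEIdeal ((ExpPoly E n).eSpan {f}) := by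
  have : IsDomain (polyERing E n) := inferInstanceAs (IsDomain (MvPolynomial (Fin n) K))
  have : UniqueFactorizationMonoid (polyERing E n) :=
    inferInstanceAs (UniqueFactorizationMonoid (MvPolynomial (Fin n) K))
  refine (polyERing E n).isPrimeEIdeal_eSpan_singleton ?_ hf
  rintro _ ⟨c, rfl⟩ hc
  have hc0 : c ≠ 0 := by
    rintro rfl
    exact hc (map_zero _)
  exact (IsUnit.mk0 c hc0).map (MvPolynomial.C (σ := Fin n))
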